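/- Let $\mathbb{A}$ be a finite set, and let $\mathcal{M}_s(\mathbb{A}^2)$ be the set of stationary distributions on $\mathbb{A}^2$, i.e. of probability vectors $\nu=(\nu_{ij})_{i,j\in\mathbb{A}}$ with $\sum_j\nu_{ij}=\sum_j\nu_{ji}=:\bar\nu_i$ for all $i$, equipped with the total variation ($\ell_1$) metric. Let $\{X_t\}_{t\ge 1}$ be a stationary Markov chain with values in $\mathbb{A}$ and doublet frequencies $\mu_{ij}=\Pr\{X_t=i,\,X_{t+1}=j\}$, and suppose that $\mu_{ij}>0$ for all $i,j\in\mathbb{A}$. For $l\ge 1$ let $\nu(X_1^l)\in\mathcal{M}_s(\mathbb{A}^2)$ be the empirical estimate $$\nu_{ij}(X_1^l)=\frac1l\,\bigl|\{1\le t\le l:\ X_t=i,\ X_{t+1}=j\}\bigr|,$$ where, in this formula only, $X_{l+1}$ is replaced by $X_1$ (a "ghost" transition $X_l\to X_1$ is added). Put $$I(\nu)=D_c(\nu\Vert\mu):=D(\nu\Vert\mu)-D(\bar\nu\Vert\bar\mu),\qquad \nu\in\mathcal{M}_s(\mathbb{A}^2),$$ where $D(\nu\Vert\mu)=\sum_k\nu_k\log(\nu_k/\mu_k)$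 is the relative entropy, with $0\log 0=0$. Then the process $\{\nu(X_1^l)\}_{l\ge1}$ satisfies the large deviation property on $\mathcal{M}_s(\mathbb{A}^2)$ with rate function $I$: for every open $\Gamma\subseteq\mathcal{M}_s(\mathbb{A}^2)$, $$-\inf_{\nu\in\Gamma}I(\nu)\le\liminf_{l\to\infty}\frac1l\log\Pr\{\nu(X_1^l)\in\Gamma\},$$ and for every closed $\Gamma\subseteq\mathcal{M}_s(\mathbb{A}^2)$, $$\limsup_{l\to\infty}\frac1l\log\Pr\{\nu(X_1^l)\in\Gamma\}\le-\inf_{\nu\in\Gamma}I(\nu),$$ with $\log 0=-\infty$ and $\inf\emptyset=+\infty$. Moreover $I$ is lower semicontinuous, and for every $\nu\in\mathcal{M}_s(\mathbb{A}^2)$ $$I(\nu)=\sum_{i\in\mathbb{A}}\bar\nu_i\sum_{j\in\mathbb{A}}c_{ij}\log\frac{c_{ij}}{a_{ij}},\qquad c_{ij}=\frac{\nu_{ij}}{\bar\nu_i},\quad a_{ij}=\frac{\mu_{ij}}{\bar\mu_i},$$ where terms with $\bar\nu_i=0$ are taken as $0$. -/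

import Mathlib

open Filter Topology MeasureTheory ProbabilityTheory

noncomputable section

/-- The set `M_s(A²)` of stationary (consistent) probability distributions on `A × A`: its row
and column marginals agree. It carries the subspace topology from `ℝ^(A × A)`, which is the
topology of the `ℓ₁` (total variation) metric. -/
def stationaryDist (A : Type*) [Fintype A] : Set (A × A → ℝ) :=
  {ν | ν ∈ stdSimplex ℝ (A × A) ∧ ∀ i, ∑ j, ν (i, j) = ∑ j, ν (j, i)}

/-- The one-dimensional marginal `ν̄ᵢ = ∑ⱼ νᵢⱼ`. -/
def marginal {A : Type*} [Fintype A] (ν : A × A → ℝ) (i : A) : ℝ := ∑ j, ν (i, j)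

/-- The transition matrix `νᵢⱼ / ν̄ᵢ` of a doublet distribution. -/
def transition {A : Type*} [Fintype A] (ν : A × A → ℝ) (i j : A) : ℝ :=
  ν (i, j) / marginal ν i

/-- Relative entropy `D(ν‖μ) = ∑ᵢ νᵢ log (νᵢ / μᵢ)` of distributions on a finite set, with
`0 log 0 = 0`. It is only used for strictly positive `μ`, where it is finite. -/
def relEntropy {B : Type*} [Fintype B] (ν μ : B → ℝ) : ℝ :=
  ∑ i, ν i * Real.log (ν i / μ i)

/-- Conditional relative entropy `D_c(ν‖μ) = D(ν‖μ) - D(ν̄‖μ̄)`. -/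
def condRelEntropy {A : Type*} [Fintype A] (ν μ : A × A → ℝ) : ℝ :=
  relEntropy ν μ - relEntropy (marginal ν) (marginal μ)

/-- `X 0, X 1, X 2, …` is a stationary Markov chain with values in the finite alphabet `A`:
its finite-dimensional distributions are invariant under time shifts, and the conditional
distribution of the next state given the whole past depends only on the current state. -/
structure IsStationaryMarkovChain {Ω A : Type*} [MeasurableSpace Ω] [MeasurableSpace A]
    (P : Measure Ω) (X : ℕ → Ω → A) : Prop where
  measurable : ∀ t, Measurable (X t)
  stationary : ∀ (k t : ℕ) (x : Fin k → A),
    P {ω | ∀ s : Fin k, X (t + s) ω = x s} = P {ω | ∀ s : Fin k, X s ω = x s}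
  markov : ∀ (t : ℕ) (x : ℕ → A) (j : A), P {ω | ∀ s ≤ t, X s ω = x s} ≠ 0 →
    cond P {ω | ∀ s ≤ t, X s ω = x s} {ω | X (t + 1) ω = j} =
      cond P {ω | X t ω = x t} {ω | X (t + 1) ω = j}

/-- `μ` is the vector of doublet frequencies `μᵢⱼ = Pr {X_t = i, X_{t+1} = j}` of the process. -/
def HasDoubletFrequency {Ω A : Type*} [MeasurableSpace Ω] (P : Measure Ω) (X : ℕ → Ω → A)
    (μ : A × A → ℝ) : Prop :=
  ∀ (t : ℕ) (i j : A), P.real {ω | X t ω = i ∧ X (t + 1) ω = j} = μ (i, j)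

/-- The empirical doublet frequencies of a sample path of length `l`, with the ghost transition
from the last sample back to the first one: `finRotate l` is the cyclic successor on `Fin l`. -/
def empiricalVec {A : Type*} [DecidableEq A] {l : ℕ} (x : Fin l → A) (p : A × A) : ℝ :=
  (1 / (l : ℝ)) * ∑ t : Fin l, if x t = p.1 ∧ x (finRotate l t) = p.2 then 1 else 0

theorem empiricalVec_row {A : Type*} [Fintype A] [DecidableEq A] {l : ℕ} (x : Fin l → A)
    (i : A) : ∑ j, empiricalVec x (i, j) =
      (1 / (l : ℝ)) * ∑ t : Fin l, if x t = i then 1 else 0 := by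
  simp only [empiricalVec, ← Finset.mul_sum]
  rw [Finset.sum_comm]
  congr 1
  refine Finset.sum_congr rfl fun t _ => ?_
  by_cases h : x t = i <;> simp [h]

theorem empiricalVec_col {A : Type*} [Fintype A] [DecidableEq A] {l : ℕ} (x : Fin l → A)
    (i : A) : ∑ j, empiricalVec x (j, i) =
      (1 / (l : ℝ)) * ∑ t : Fin l, if x t = i then 1 else 0 := by
  simp only [empiricalVec, ← Finset.mul_sum]
  rw [Finset.sum_comm, ← Equiv.sum_comp (finRotate l) (fun t => if x t = i then (1 : ℝ) else 0)]
  congr 1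
  refine Finset.sum_congr rfl fun t _ => ?_
  generalize x (finRotate l t) = a
  by_cases h : a = i <;> simp [h]

theorem empiricalVec_mem {A : Type*} [Fintype A] [DecidableEq A] {l : ℕ} (hl : 0 < l)
    (x : Fin l → A) : empiricalVec x ∈ stationaryDist A := by
  refine ⟨⟨fun p => ?_, ?_⟩, fun i => by rw [empiricalVec_row, empiricalVec_col]⟩
  · unfold empiricalVec
    refine mul_nonneg (by positivity) (Finset.sum_nonneg fun t _ => ?_)
    split_ifs <;> norm_num
  · rw [Fintype.sum_prod_type]
    simp only [empiricalVec_row, ← Finset.mul_sum]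
    rw [Finset.sum_comm]
    have : (l : ℝ) ≠ 0 := by positivity
    simp [this]

/-- The empirical doublet estimate from the first `l ≥ 1` samples of the process,
as a random element of `M_s(A²)`. -/
def empiricalDoublet {Ω A : Type*} [Fintype A] [DecidableEq A] (X : ℕ → Ω → A) (l : ℕ+)
    (ω : Ω) : stationaryDist A :=
  ⟨empiricalVec (fun t : Fin (l : ℕ) => X t ω), empiricalVec_mem l.pos _⟩

/-- `(1 / l) log Pr {Y_l ∈ Γ}`, with value `-∞` when the probability is zero. -/
def normLogProb {Ω S : Type*} [MeasurableSpace Ω] (P : Measure Ω) (Y : ℕ+ → Ω → S)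
    (Γ : Set S) (l : ℕ+) : EReal :=
  ((1 / ((l : ℕ) : ℝ) : ℝ) : EReal) * ENNReal.log (P {ω | Y l ω ∈ Γ})

/-- The process `Y_1, Y_2, …` satisfies the large deviation property with rate function `I`;
infima over the empty set are `+∞`. -/
structure SatisfiesLDP {Ω S : Type*} [MeasurableSpace Ω] [TopologicalSpace S] (P : Measure Ω)
    (Y : ℕ+ → Ω → S) (I : S → EReal) : Prop where
  lower : ∀ Γ : Set S, IsOpen Γ → -(⨅ ν ∈ Γ, I ν) ≤ liminf (normLogProb P Y Γ) atTop
  upper : ∀ Γ : Set S, IsClosed Γ → limsup (normLogProb P Y Γ) atTop ≤ -(⨅ ν ∈ Γ, I ν)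

end

/-!
The proof is the method of types, carried out on closed walks so that no count of walks is needed.

Because of the ghost transition, a sample path `x` is a closed walk, and its weight
`cycleWeight a x` for the transition matrix `a` of `μ` depends on `x` only through its empirical
doublet. The probability of the path equals this weight up to a factor bounded away from `0` and
`∞` (`exists_measureReal_cycle_bounds`). If `ν` is the empirical doublet of `x`, replacing `a` by
the transition matrix of `ν` changes the weight by exactly `exp (-l I(ν))`
(`cycleWeight_transition_eq`).

Upper bound: all closed walks together have weight at most `|A|` for any substochastic matrix, and
there are only polynomially many empirical doublets, so the walks with `r ≤ I(ν)` have total weight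
at most `|A| (l + 1) ^ |A × A| exp (-l r)` (`sum_cycleWeight_le_exp`).

Lower bound: by density and continuity it is enough to treat a positive `ν`. Tilting to the
transition matrix of `ν` costs `exp (-l I(ν))` near `ν` (`exists_exp_le_sum_cycleWeight`), and it
remains to see that the tilted weight concentrates near `ν`. This law of large numbers
(`exists_le_sum_cycleWeight_of_nhds`) is the upper bound for the tilted matrix: its rate function is
continuous on a compact set and vanishes only at `ν` (`condRelEntropy_pos`), by Gibbs' inequality
and uniqueness of the stationary vector of a positive matrix.
-/

/-! ### Conditional relative entropy -/

section Entropy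

variable {A : Type*} [Fintype A]

theorem marginal_nonneg {ν : A × A → ℝ} (h : ∀ p, 0 ≤ ν p) (i : A) : 0 ≤ marginal ν i :=
  Finset.sum_nonneg fun j _ => h (i, j)

theorem le_marginal {ν : A × A → ℝ} (h : ∀ p, 0 ≤ ν p) (i j : A) : ν (i, j) ≤ marginal ν i :=
  Finset.single_le_sum (f := fun j => ν (i, j)) (fun j _ => h (i, j)) (Finset.mem_univ j)

theorem transition_nonneg {ν : A × A → ℝ} (h : ∀ p, 0 ≤ ν p) (i j : A) :
    0 ≤ transition ν i j :=
  div_nonneg (h _) (marginal_nonneg h i)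

theorem transition_le_one {ν : A × A → ℝ} (h : ∀ p, 0 ≤ ν p) (i j : A) :
    transition ν i j ≤ 1 :=
  div_le_one_of_le₀ (le_marginal h i j) (marginal_nonneg h i)

theorem transition_pos {ν : A × A → ℝ} (h : ∀ p, 0 ≤ ν p) {i j : A} (hij : 0 < ν (i, j)) :
    0 < transition ν i j :=
  div_pos hij (hij.trans_le (le_marginal h i j))

theorem sum_transition_le_one (ν : A × A → ℝ) (i : A) : ∑ j, transition ν i j ≤ 1 := by
  simp only [transition, ← Finset.sum_div]
  exact div_self_le_one (marginal ν i)

theorem sum_transition_eq_one {ν : A × A → ℝ} {i : A} (h : marginal ν i ≠ 0) :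
    ∑ j, transition ν i j = 1 := by
  simp only [transition, ← Finset.sum_div]
  exact div_self h

theorem marginal_mul_transition {ν : A × A → ℝ} (h : ∀ p, 0 ≤ ν p) (i j : A) :
    marginal ν i * transition ν i j = ν (i, j) := by
  rcases (marginal_nonneg h i).eq_or_lt with h0 | h0
  · have : ν (i, j) = 0 := le_antisymm (h0 ▸ le_marginal h i j) (h _)
    rw [this, ← h0, zero_mul]
  · exact mul_div_cancel₀ _ h0.ne'

theorem condRelEntropy_eq_sum {ν μ : A × A → ℝ} (hν : ∀ p, 0 ≤ ν p) (hμ : ∀ p, 0 < μ p) :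
    condRelEntropy ν μ =
      ∑ p : A × A, ν p * Real.log (transition ν p.1 p.2 / transition μ p.1 p.2) := by
  have hm : relEntropy (marginal ν) (marginal μ) =
      ∑ p : A × A, ν p * Real.log (marginal ν p.1 / marginal μ p.1) := by
    rw [relEntropy, Fintype.sum_prod_type]
    exact Finset.sum_congr rfl fun i _ => Finset.sum_mul _ _ _
  rw [condRelEntropy, hm, relEntropy, ← Finset.sum_sub_distrib]
  refine Finset.sum_congr rfl fun p _ => ?_
  rcases (hν p).eq_or_lt with h0 | h0
  · simp [← h0]
  · have h1 : 0 < marginal ν p.1 := h0.trans_le (le_marginal hν p.1 p.2)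
    have h2 : 0 < marginal μ p.1 := (hμ p).trans_le (le_marginal (fun p => (hμ p).le) p.1 p.2)
    rw [← mul_sub, ← Real.log_div (div_pos h0 (hμ p)).ne' (div_pos h1 h2).ne']
    congr 2
    have := (hμ p).ne'
    simp only [transition, Prod.mk.eta]
    field_simp

theorem condRelEntropy_eq_sum_marginal {ν μ : A × A → ℝ} (hν : ∀ p, 0 ≤ ν p)
    (hμ : ∀ p, 0 < μ p) :
    condRelEntropy ν μ = ∑ i, marginal ν i * ∑ j, transition ν i j *
      Real.log (transition ν i j / transition μ i j) := by
  rw [condRelEntropy_eq_sum hν hμ, Fintype.sum_prod_type]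
  refine Finset.sum_congr rfl fun i _ => ?_
  rw [Finset.mul_sum]
  exact Finset.sum_congr rfl fun j _ => by rw [← mul_assoc, marginal_mul_transition hν]

/-- Each term is `μ i * (x log x)` at `x = ν i / μ i`, or vanishes if `μ i = 0`. -/
theorem continuous_relEntropy_left {B : Type*} [Fintype B] (μ : B → ℝ) :
    Continuous fun ν : B → ℝ => relEntropy ν μ := by
  refine continuous_finsetSum _ fun i _ => ?_
  by_cases h : μ i = 0
  · simp [h, continuous_const]
  · have h1 : Continuous fun ν : B → ℝ => ν i / μ i := by fun_prop
    refine ((Real.continuous_mul_log.comp h1).const_mul (μ i)).congr fun ν => ?_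
    simp only [Function.comp_apply]
    field_simp

theorem continuous_condRelEntropy_left (μ : A × A → ℝ) :
    Continuous fun ν : A × A → ℝ => condRelEntropy ν μ := by
  have h : Continuous fun ν : A × A → ℝ => marginal ν :=
    continuous_pi fun i => continuous_finsetSum _ fun j _ => continuous_apply _
  exact (continuous_relEntropy_left μ).sub
    ((continuous_relEntropy_left (marginal μ)).comp h)

/-- A positive stochastic matrix has at most one stationary probability vector. The ratio of two
stationary vectors attains its minimum, and stationarity at the minimizer forces the ratio to be
constant. -/
theorem eq_of_stationary {c : A → A → ℝ} (hc : ∀ i j, 0 < c i j) {u v : A → ℝ}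
    (hv : ∀ i, 0 < v i) (huc : ∀ j, ∑ i, u i * c i j = u j) (hvc : ∀ j, ∑ i, v i * c i j = v j)
    (hu1 : ∑ i, u i = 1) (hv1 : ∑ i, v i = 1) : u = v := by
  have hne : Nonempty A := by
    by_contra h
    rw [not_nonempty_iff] at h
    simp at hv1
  obtain ⟨k, hk⟩ := Finite.exists_min fun i => u i / v i
  have hle : ∀ i, 0 ≤ u i - u k / v k * v i := fun i => by
    have := (le_div_iff₀ (hv i)).1 (hk i)
    linarith
  have hz : ∑ i, (u i - u k / v k * v i) * c i k = 0 := by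
    simp only [sub_mul, Finset.sum_sub_distrib, mul_assoc, ← Finset.mul_sum, huc, hvc]
    have := (hv k).ne'
    field_simp
    ring
  have hz' : ∀ i, u i = u k / v k * v i := fun i => by
    have := (Finset.sum_eq_zero_iff_of_nonneg
      (fun i _ => mul_nonneg (hle i) (hc i k).le)).1 hz i (Finset.mem_univ i)
    rcases mul_eq_zero.1 this with h | h
    · linarith
    · exact absurd h (hc i k).ne'
  have h1 : u k / v k = 1 := by
    have := hu1
    rw [Finset.sum_congr rfl fun i _ => hz' i, ← Finset.mul_sum, hv1] at this
    linarith
  ext i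
  rw [hz' i, h1, one_mul]

theorem sum_marginal {ν : A × A → ℝ} (hν : ν ∈ stationaryDist A) : ∑ i, marginal ν i = 1 := by
  rw [← hν.1.2, Fintype.sum_prod_type]; rfl

/-- The rate function vanishes only at the doublet distribution of the chain itself: by Gibbs'
inequality its zeros have the transition matrix of `μ`, which has one stationary vector. -/
theorem condRelEntropy_pos {ν μ : A × A → ℝ} (hν : ν ∈ stationaryDist A)
    (hμ : μ ∈ stationaryDist A) (hpos : ∀ p, 0 < μ p) (hne : ν ≠ μ) :
    0 < condRelEntropy ν μ := by
  have hν0 := hν.1.1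
  have hm : ∀ i, 0 < marginal μ i := fun i =>
    (hpos (i, i)).trans_le (le_marginal (fun p => (hpos p).le) i i)
  have ha : ∀ i j, 0 < transition μ i j := fun i j => div_pos (hpos _) (hm i)
  set q : A × A → ℝ := fun p => marginal ν p.1 * transition μ p.1 p.2 with hq
  have hqsum : ∑ p, q p = 1 := by
    rw [Fintype.sum_prod_type]
    simp only [hq, ← Finset.mul_sum, sum_transition_eq_one (hm _).ne', mul_one]
    exact sum_marginal hν
  -- The rate is a sum of divergences `q * klFun (ν / q)`, as `ν` and `q` have equal total mass.
  have hterm : ∀ p : A × A, ν p * Real.log (transition ν p.1 p.2 / transition μ p.1 p.2)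
      = q p * InformationTheory.klFun (ν p / q p) + (ν p - q p) := by
    intro p
    rcases (marginal_nonneg hν0 p.1).eq_or_lt with h0 | h0
    · have h1 : ν p = 0 := le_antisymm (h0 ▸ le_marginal hν0 p.1 p.2) (hν0 _)
      simp [hq, h1, ← h0]
    · have hqp : q p ≠ 0 := (mul_pos h0 (ha _ _)).ne'
      have : transition ν p.1 p.2 / transition μ p.1 p.2 = ν p / q p := by
        simp only [hq, transition, Prod.mk.eta, div_div]
      rw [this, InformationTheory.klFun]
      field_simp
      ring
  have hq0 : ∀ p, 0 ≤ q p := fun p => mul_nonneg (marginal_nonneg hν0 _) (ha _ _).le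
  have hkl : ∀ p, 0 ≤ q p * InformationTheory.klFun (ν p / q p) := fun p =>
    mul_nonneg (hq0 p) (InformationTheory.klFun_nonneg (div_nonneg (hν0 p) (hq0 p)))
  rw [condRelEntropy_eq_sum hν0 hpos]
  simp only [hterm, Finset.sum_add_distrib, Finset.sum_sub_distrib, hqsum, hν.1.2, sub_self,
    add_zero]
  refine (Finset.sum_nonneg fun p _ => hkl p).lt_of_ne' fun hzero => hne ?_
  have hνq : ∀ p, ν p = q p := by
    intro p
    have h := (Finset.sum_eq_zero_iff_of_nonneg fun p _ => hkl p).1 hzero p (Finset.mem_univ p)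
    rcases (marginal_nonneg hν0 p.1).eq_or_lt with h0 | h0
    · have h1 : ν p = 0 := le_antisymm (h0 ▸ le_marginal hν0 p.1 p.2) (hν0 _)
      simp [hq, h1, ← h0]
    · have hqp : q p ≠ 0 := (mul_pos h0 (ha _ _)).ne'
      have h2 := (mul_eq_zero.1 h).resolve_left hqp
      rw [InformationTheory.klFun_eq_zero_iff (div_nonneg (hν0 p) (hq0 p))] at h2
      exact (div_eq_one_iff_eq hqp).1 h2
  have hmarg : marginal ν = marginal μ := by
    refine eq_of_stationary ha hm (fun j => ?_) (fun j => ?_) (sum_marginal hν) (sum_marginal hμ)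
    · rw [show marginal ν j = ∑ i, ν (i, j) from hν.2 j]
      exact Finset.sum_congr rfl fun i _ => (hνq (i, j)).symm
    · rw [show marginal μ j = ∑ i, μ (i, j) from hμ.2 j]
      exact Finset.sum_congr rfl fun i _ => marginal_mul_transition (fun p => (hpos p).le) i j
  ext p
  rw [hνq p, hq]
  simp only [hmarg]
  exact marginal_mul_transition (fun p => (hpos p).le) p.1 p.2

theorem isCompact_stationaryDist : IsCompact (stationaryDist A) := by
  refine (isCompact_stdSimplex ℝ (A × A)).inter_right (t := {ν | ∀ i, _}) ?_
  simp only [Set.ofPred_forall]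
  exact isClosed_iInter fun i => isClosed_eq
    (continuous_finsetSum _ fun j _ => continuous_apply _)
    (continuous_finsetSum _ fun j _ => continuous_apply _)

/-- The uniform gap that turns the upper large deviation bound into a law of large numbers. -/
theorem exists_pos_le_condRelEntropy {μ : A × A → ℝ} (hμ : μ ∈ stationaryDist A)
    (hpos : ∀ p, 0 < μ p) {U : Set (A × A → ℝ)} (hU : IsOpen U) (hμU : μ ∈ U) :
    ∃ r > 0, ∀ ν ∈ stationaryDist A, ν ∉ U → r ≤ condRelEntropy ν μ := by
  obtain hK | hK := (stationaryDist A ∩ Uᶜ).eq_empty_or_nonempty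
  · exact ⟨1, one_pos, fun ν h1 h2 => absurd (show ν ∈ stationaryDist A ∩ Uᶜ from ⟨h1, h2⟩)
      (hK ▸ Set.notMem_empty ν)⟩
  · obtain ⟨κ, hκ, hmin⟩ := (isCompact_stationaryDist.inter_right hU.isClosed_compl).exists_isMinOn
      hK (continuous_condRelEntropy_left μ).continuousOn
    exact ⟨_, condRelEntropy_pos hκ.1 hμ hpos fun h => hκ.2 (h ▸ hμU),
      fun ν h1 h2 => hmin ⟨h1, h2⟩⟩

/-- Positive stationary distributions are dense: mix with the uniform one. -/
theorem exists_pos_stationaryDist {ν : A × A → ℝ} (hν : ν ∈ stationaryDist A)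
    {U : Set (A × A → ℝ)} (hU : IsOpen U) (hνU : ν ∈ U) :
    ∃ κ ∈ stationaryDist A, κ ∈ U ∧ ∀ p, 0 < κ p := by
  have hcard : 0 < (Fintype.card (A × A) : ℝ) := by
    have : Nonempty (A × A) := by
      by_contra h
      rw [not_nonempty_iff] at h
      simpa using hν.1.2
    exact_mod_cast Fintype.card_pos
  set f : ℝ → A × A → ℝ := fun ε p => (1 - ε) * ν p + ε * (1 / Fintype.card (A × A)) with hf
  have hcont : Continuous f := by rw [hf]; fun_prop
  have h0 : f 0 = ν := by ext p; simp [hf]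
  have hmem : ∀ᶠ ε in 𝓝[>] (0 : ℝ), f ε ∈ U :=
    (hcont.tendsto 0).mono_left nhdsWithin_le_nhds (hU.mem_nhds (h0 ▸ hνU))
  obtain ⟨ε, hε, hε0, hε1⟩ := (hmem.and (Ioo_mem_nhdsGT one_pos)).exists
  have hp : ∀ p, 0 < f ε p := fun p => by
    have := mul_nonneg (sub_nonneg.2 hε1.le) (hν.1.1 p)
    have : 0 < ε * (1 / (Fintype.card (A × A) : ℝ)) := by positivity
    simp only [hf]
    linarith
  refine ⟨f ε, ⟨⟨fun p => (hp p).le, ?_⟩, fun i => ?_⟩, hε, hp⟩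
  · simp only [hf, Finset.sum_add_distrib, ← Finset.mul_sum, hν.1.2, Finset.sum_const,
      Finset.card_univ, nsmul_eq_mul]
    field_simp
    ring
  · simp only [hf, Finset.sum_add_distrib, ← Finset.mul_sum, hν.2 i]

end Entropy

/-! ### Weights of closed walks and the method of types -/

section CycleWeight

variable {A : Type*}

/-- The weight of the closed walk `x 0 → x 1 → ⋯ → x (l - 1) → x 0` for the transition matrix
`c`; the last factor is the ghost transition. -/
def cycleWeight (c : A → A → ℝ) {l : ℕ} (x : Fin l → A) : ℝ :=
  ∏ t : Fin l, c (x t) (x (finRotate l t))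

/-- The weight of the open walk `x 0 → x 1 → ⋯ → x n` for the transition matrix `c`. -/
def pathWeight (c : A → A → ℝ) {n : ℕ} (x : Fin (n + 1) → A) : ℝ :=
  ∏ t : Fin n, c (x t.castSucc) (x t.succ)

theorem cycleWeight_eq_pathWeight_mul (c : A → A → ℝ) {n : ℕ} (x : Fin (n + 1) → A) :
    cycleWeight c x = pathWeight c x * c (x (Fin.last n)) (x 0) := by
  simp [cycleWeight, pathWeight, Fin.prod_univ_castSucc]

theorem pathWeight_snoc (c : A → A → ℝ) {n : ℕ} (x : Fin (n + 1) → A) (j : A) :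
    pathWeight c (Fin.snoc x j : Fin (n + 2) → A) = pathWeight c x * c (x (Fin.last n)) j := by
  rw [pathWeight, Fin.prod_univ_castSucc, pathWeight]
  simp only [← Fin.castSucc_succ, Fin.snoc_castSucc, Fin.succ_last, Fin.snoc_last]

theorem cycleWeight_nonneg {c : A → A → ℝ} (hc : ∀ i j, 0 ≤ c i j) {l : ℕ} (x : Fin l → A) :
    0 ≤ cycleWeight c x :=
  Finset.prod_nonneg fun _ _ => hc _ _

theorem pathWeight_nonneg {c : A → A → ℝ} (hc : ∀ i j, 0 ≤ c i j) {n : ℕ}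
    (x : Fin (n + 1) → A) : 0 ≤ pathWeight c x :=
  Finset.prod_nonneg fun _ _ => hc _ _

theorem empiricalVec_apply_pos [DecidableEq A] {l : ℕ} (x : Fin l → A) (t : Fin l) :
    0 < empiricalVec x (x t, x (finRotate l t)) := by
  have hl : (0 : ℝ) < l := by exact_mod_cast t.pos
  refine mul_pos (by positivity) (Finset.sum_pos' (fun s _ => ?_) ⟨t, Finset.mem_univ t, ?_⟩)
  · split_ifs <;> norm_num
  · simp

variable [Fintype A]

theorem sum_pathWeight_succ (c : A → A → ℝ) (n : ℕ) :
    ∑ x : Fin (n + 2) → A, pathWeight c x =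
      ∑ x : Fin (n + 1) → A, pathWeight c x * ∑ j, c (x (Fin.last n)) j := by
  rw [← (Fin.snocEquiv fun _ : Fin (n + 2) => A).sum_comp, Fintype.sum_prod_type, Finset.sum_comm]
  refine Finset.sum_congr rfl fun x _ => ?_
  rw [Finset.mul_sum]
  exact Finset.sum_congr rfl fun j _ => pathWeight_snoc c x j

theorem sum_pathWeight_le {c : A → A → ℝ} (hc : ∀ i j, 0 ≤ c i j) (h1 : ∀ i, ∑ j, c i j ≤ 1)
    (n : ℕ) : ∑ x : Fin (n + 1) → A, pathWeight c x ≤ Fintype.card A := by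
  induction n with
  | zero => simp [pathWeight]
  | succ n ih =>
    rw [sum_pathWeight_succ]
    exact (Finset.sum_le_sum fun x _ =>
      mul_le_of_le_one_right (pathWeight_nonneg hc x) (h1 _)).trans ih

theorem sum_pathWeight_eq {c : A → A → ℝ} (h1 : ∀ i, ∑ j, c i j = 1) (n : ℕ) :
    ∑ x : Fin (n + 1) → A, pathWeight c x = Fintype.card A := by
  induction n with
  | zero => simp [pathWeight]
  | succ n ih =>
    rw [sum_pathWeight_succ]
    simpa [h1] using ih

/-- A state `i` with `marginal ν i = 0` has a zero row in `transition ν`, so this matrix is only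
substochastic, which suffices for the upper bound. -/
theorem sum_cycleWeight_transition_le {ν : A × A → ℝ} (hν : ∀ p, 0 ≤ ν p) {l : ℕ} (hl : 0 < l) :
    ∑ x : Fin l → A, cycleWeight (transition ν) x ≤ Fintype.card A := by
  obtain ⟨n, rfl⟩ := Nat.exists_eq_add_one.2 hl
  refine le_trans (Finset.sum_le_sum fun x _ => ?_)
    (sum_pathWeight_le (transition_nonneg hν) (sum_transition_le_one ν) n)
  rw [cycleWeight_eq_pathWeight_mul]
  exact mul_le_of_le_one_right (pathWeight_nonneg (transition_nonneg hν) x)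
    (transition_le_one hν _ _)

/-- Closing up a walk costs at most the smallest transition probability, so the total weight of
closed walks stays away from zero. -/
theorem exists_le_sum_cycleWeight_transition [Nonempty A] {ν : A × A → ℝ} (hν : ∀ p, 0 < ν p) :
    ∃ δ > 0, ∀ l > 0, δ ≤ ∑ x : Fin l → A, cycleWeight (transition ν) x := by
  have hν' : ∀ p, 0 ≤ ν p := fun p => (hν p).le
  obtain ⟨q, hq⟩ := Finite.exists_min fun p : A × A => transition ν p.1 p.2
  have hq0 := transition_pos hν' (hν q)
  refine ⟨Fintype.card A * transition ν q.1 q.2,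
    mul_pos (by exact_mod_cast Fintype.card_pos) hq0, fun l hl => ?_⟩
  obtain ⟨n, rfl⟩ := Nat.exists_eq_add_one.2 hl
  rw [← sum_pathWeight_eq (c := transition ν) (fun i => sum_transition_eq_one
    ((hν (i, i)).trans_le (le_marginal hν' i i)).ne') n, Finset.sum_mul]
  refine Finset.sum_le_sum fun x _ => ?_
  rw [cycleWeight_eq_pathWeight_mul]
  exact mul_le_mul_of_nonneg_left (hq (_, _)) (pathWeight_nonneg (transition_nonneg hν') x)

variable [DecidableEq A]

/-- Sums along the closed walk depend on the walk only through its empirical doublets. -/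
theorem sum_cycle_eq {l : ℕ} (hl : 0 < l) (x : Fin l → A) (g : A × A → ℝ) :
    ∑ t : Fin l, g (x t, x (finRotate l t)) = l * ∑ p, empiricalVec x p * g p := by
  have hl' : (l : ℝ) ≠ 0 := by positivity
  simp only [empiricalVec, mul_assoc, ← Finset.mul_sum, Finset.sum_mul]
  rw [← mul_assoc, mul_one_div_cancel hl', one_mul, Finset.sum_comm]
  refine Finset.sum_congr rfl fun t _ => ?_
  rw [Finset.sum_eq_single (x t, x (finRotate l t))]
  · simp
  · rintro ⟨i, j⟩ - hp
    rw [if_neg, zero_mul]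
    rintro ⟨rfl, rfl⟩
    exact hp rfl
  · simp

/-- Change of measure between two transition matrices along a closed walk. -/
theorem cycleWeight_eq_exp_mul {l : ℕ} (hl : 0 < l) (x : Fin l → A) {a c : A → A → ℝ}
    (ha : ∀ i j, 0 < a i j) (hc : ∀ t, 0 < c (x t) (x (finRotate l t))) :
    cycleWeight a x =
      Real.exp (-(l * ∑ p, empiricalVec x p * Real.log (c p.1 p.2 / a p.1 p.2))) *
        cycleWeight c x := by
  rw [← sum_cycle_eq hl x fun p => Real.log (c p.1 p.2 / a p.1 p.2), ← Finset.sum_neg_distrib,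
    Real.exp_sum, cycleWeight, cycleWeight, ← Finset.prod_mul_distrib]
  refine Finset.prod_congr rfl fun t _ => ?_
  have h1 := ha (x t) (x (finRotate l t))
  have h2 := hc t
  rw [Real.exp_neg, Real.exp_log (div_pos h2 h1)]
  field_simp

theorem cycleWeight_transition_eq {l : ℕ} (hl : 0 < l) (x : Fin l → A) {μ : A × A → ℝ}
    (hμ : ∀ p, 0 < μ p) :
    cycleWeight (transition μ) x = Real.exp (-(l * condRelEntropy (empiricalVec x) μ)) *
      cycleWeight (transition (empiricalVec x)) x := by
  have h0 := (empiricalVec_mem hl x).1.1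
  rw [condRelEntropy_eq_sum h0 hμ]
  exact cycleWeight_eq_exp_mul hl x (fun i j => transition_pos (fun p => (hμ p).le) (hμ _))
    fun t => transition_pos h0 (empiricalVec_apply_pos x t)

/-- There are only polynomially many empirical doublets of walks of length `l`. -/
theorem card_image_empiricalVec_le (l : ℕ) :
    (Finset.univ.image (empiricalVec : (Fin l → A) → A × A → ℝ)).card ≤
      (l + 1) ^ Fintype.card (A × A) := by
  have hsub : Finset.univ.image (empiricalVec : (Fin l → A) → A × A → ℝ) ⊆
      Finset.univ.image fun (k : A × A → Fin (l + 1)) p => 1 / (l : ℝ) * (k p : ℕ) := by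
    intro ν hν
    obtain ⟨x, -, rfl⟩ := Finset.mem_image.1 hν
    refine Finset.mem_image.2 ⟨fun p => ⟨(Finset.univ.filter fun t : Fin l =>
      x t = p.1 ∧ x (finRotate l t) = p.2).card, Nat.lt_succ_of_le ?_⟩, Finset.mem_univ _, ?_⟩
    · exact (Finset.card_le_univ _).trans (Fintype.card_fin l).le
    · ext p
      simp [empiricalVec]
  refine (Finset.card_le_card hsub).trans (Finset.card_image_le.trans ?_)
  simp

/-- The method of types: walks with a fixed empirical doublet `ν` have total weight at most
`|A| exp (-l I(ν))`, since the matrix `transition ν` gives them total weight at most `|A|`. -/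
theorem sum_cycleWeight_le_exp {μ : A × A → ℝ} (hμ : ∀ p, 0 < μ p) {l : ℕ} (hl : 0 < l)
    (E : Finset (Fin l → A)) {r : ℝ} (hr : ∀ x ∈ E, r ≤ condRelEntropy (empiricalVec x) μ) :
    ∑ x ∈ E, cycleWeight (transition μ) x ≤
      Fintype.card A * ((l : ℝ) + 1) ^ Fintype.card (A × A) * Real.exp (-(l * r)) := by
  have hW : ∀ x : Fin l → A, 0 ≤ cycleWeight (transition (empiricalVec x)) x := fun x =>
    cycleWeight_nonneg (transition_nonneg (empiricalVec_mem hl x).1.1) x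
  have h1 : ∑ x ∈ E, cycleWeight (transition μ) x ≤
      Real.exp (-(l * r)) * ∑ x : Fin l → A, cycleWeight (transition (empiricalVec x)) x := by
    rw [Finset.mul_sum]
    refine (Finset.sum_le_sum fun x hx => ?_).trans
      (Finset.sum_le_univ_sum_of_nonneg fun x => mul_nonneg (Real.exp_pos _).le (hW x))
    rw [cycleWeight_transition_eq hl x hμ]
    have := hr x hx
    have := hW x
    gcongr
  have h2 : ∑ x : Fin l → A, cycleWeight (transition (empiricalVec x)) x ≤
      ((l : ℝ) + 1) ^ Fintype.card (A × A) * Fintype.card A := by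
    rw [← Finset.sum_fiberwise_of_maps_to (g := empiricalVec)
      (t := Finset.univ.image empiricalVec) fun x hx => Finset.mem_image_of_mem _ hx]
    refine (Finset.sum_le_card_nsmul _ _ (Fintype.card A : ℝ) fun ν hν => ?_).trans ?_
    · obtain ⟨y, -, rfl⟩ := Finset.mem_image.1 hν
      have hy := (empiricalVec_mem hl y).1.1
      refine le_trans ?_ (sum_cycleWeight_transition_le hy hl)
      rw [Finset.sum_congr rfl fun x hx => by rw [(Finset.mem_filter.1 hx).2]]
      exact Finset.sum_le_univ_sum_of_nonneg fun x => cycleWeight_nonneg (transition_nonneg hy) x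
    · rw [nsmul_eq_mul]
      gcongr
      exact_mod_cast card_image_empiricalVec_le l
  calc _ ≤ _ := h1
    _ ≤ _ := mul_le_mul_of_nonneg_left h2 (Real.exp_pos _).le
    _ = _ := by ring

/-- The law of large numbers for cycle weights: walks whose empirical doublet is close to `ν`
carry, for long walks, a fixed fraction of the weight for `transition ν`. -/
theorem exists_le_sum_cycleWeight_of_nhds [Nonempty A] {ν : A × A → ℝ}
    (hν : ν ∈ stationaryDist A) (hpos : ∀ p, 0 < ν p) {U : Set (A × A → ℝ)} (hU : IsOpen U)
    (hνU : ν ∈ U) :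
    ∃ δ > 0, ∀ᶠ l : ℕ in atTop, ∀ E : Finset (Fin l → A), (∀ x, empiricalVec x ∈ U → x ∈ E) →
      δ ≤ ∑ x ∈ E, cycleWeight (transition ν) x := by
  obtain ⟨r, hr, hrU⟩ := exists_pos_le_condRelEntropy hν hpos hU hνU
  obtain ⟨δ, hδ, htot⟩ := exists_le_sum_cycleWeight_transition hpos
  have hlim : Tendsto (fun l : ℕ => Fintype.card A * ((l : ℝ) + 1) ^ Fintype.card (A × A) *
      Real.exp (-(l * r))) atTop (𝓝 0) := by
    have h := (Real.tendsto_pow_mul_exp_neg_atTop_nhds_zero (Fintype.card (A × A))).comp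
      ((tendsto_id.const_mul_atTop hr).comp
        (tendsto_atTop_add_const_right atTop (1 : ℝ) (tendsto_natCast_atTop_atTop (R := ℝ))))
    have h' := h.const_mul (Fintype.card A * (1 / r) ^ Fintype.card (A × A) * Real.exp r)
    rw [mul_zero] at h'
    refine h'.congr fun l => ?_
    simp only [Function.comp_apply, id_eq, mul_pow, one_div]
    rw [show -(r * ((l : ℝ) + 1)) = -(l * r) - r by ring, Real.exp_sub]
    have := Real.exp_pos r
    field_simp
    rw [← mul_pow, one_div_mul_cancel hr.ne', one_pow]
  -- The total weight is at least `δ`, and the walks away from `ν` lose less than half of it.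
  refine ⟨δ / 2, half_pos hδ, ?_⟩
  filter_upwards [hlim.eventually_lt_const (half_pos hδ), eventually_gt_atTop 0] with l hl hl0 E hE
  have h1 := htot l hl0
  have h2 := sum_cycleWeight_le_exp hpos hl0 Eᶜ (r := r) fun x hx =>
    hrU _ (empiricalVec_mem hl0 x) fun h => Finset.mem_compl.1 hx (hE x h)
  have h3 := Finset.sum_add_sum_compl E fun x => cycleWeight (transition ν) x
  linarith

/-- Tilting: near a positive `ν` the weights for `transition μ` and `transition ν` differ by a
factor `exp (-l I(ν))` up to the exponential order. -/
theorem exists_exp_le_sum_cycleWeight [Nonempty A] {μ ν : A × A → ℝ} (hμ : ∀ p, 0 < μ p)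
    (hν : ν ∈ stationaryDist A) (hpos : ∀ p, 0 < ν p) {U : Set (A × A → ℝ)} (hU : IsOpen U)
    (hνU : ν ∈ U) {s : ℝ} (hs : condRelEntropy ν μ < s) :
    ∃ δ > 0, ∀ᶠ l : ℕ in atTop, ∀ E : Finset (Fin l → A), (∀ x, empiricalVec x ∈ U → x ∈ E) →
      δ * Real.exp (-(l * s)) ≤ ∑ x ∈ E, cycleWeight (transition μ) x := by
  classical
  set F : (A × A → ℝ) → ℝ := fun κ =>
    ∑ p : A × A, κ p * Real.log (transition ν p.1 p.2 / transition μ p.1 p.2) with hF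
  have hFc : Continuous F := by rw [hF]; fun_prop
  have ha : ∀ i j, 0 < transition μ i j := fun i j =>
    transition_pos (fun p => (hμ p).le) (hμ _)
  have hc : ∀ i j, 0 < transition ν i j := fun i j => transition_pos hν.1.1 (hpos _)
  -- `F` agrees with the rate function at `ν`, and is the exact exponent of the change of measure.
  obtain ⟨δ, hδ, h⟩ := exists_le_sum_cycleWeight_of_nhds hν hpos
    (hU.inter (isOpen_lt hFc continuous_const))
    ⟨hνU, (condRelEntropy_eq_sum hν.1.1 hμ).symm.trans_lt hs⟩
  refine ⟨δ, hδ, ?_⟩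
  filter_upwards [h, eventually_gt_atTop 0] with l hl hl0 E hE
  have h1 := hl (E.filter fun x => F (empiricalVec x) < s) fun x hx =>
    Finset.mem_filter.2 ⟨hE x hx.1, hx.2⟩
  calc δ * Real.exp (-(l * s))
      ≤ (∑ x ∈ E with F (empiricalVec x) < s, cycleWeight (transition ν) x) *
        Real.exp (-(l * s)) := by gcongr
    _ ≤ ∑ x ∈ E with F (empiricalVec x) < s, cycleWeight (transition μ) x := by
      rw [Finset.sum_mul]
      refine Finset.sum_le_sum fun x hx => ?_
      have hx' := (Finset.mem_filter.1 hx).2.le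
      rw [cycleWeight_eq_exp_mul hl0 x ha (c := transition ν) fun t => hc _ _, mul_comm]
      have := cycleWeight_nonneg (fun i j => (hc i j).le) x
      gcongr
    _ ≤ _ := Finset.sum_le_sum_of_subset_of_nonneg (Finset.filter_subset _ _)
      fun x _ _ => cycleWeight_nonneg (fun i j => (ha i j).le) x

end CycleWeight

/-! ### Exponential rates of probabilities -/

section Asymptotics

theorem tendsto_log_mul_pow_mul_exp_div {C : ℝ} (hC : 0 < C) (d : ℕ) (r : ℝ) :
    Tendsto (fun l : ℕ+ => 1 / ((l : ℕ) : ℝ) *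
      Real.log (C * ((l : ℕ) + 1 : ℝ) ^ d * Real.exp (-((l : ℕ) * r)))) atTop (𝓝 (-r)) := by
  have hl : Tendsto (fun l : ℕ+ => ((l : ℕ) : ℝ)) atTop atTop :=
    tendsto_natCast_atTop_atTop.comp tendsto_PNat_val_atTop_atTop
  have h1 : Tendsto (fun l : ℕ+ => Real.log ((l : ℕ) + 1 : ℝ) / ((l : ℕ) : ℝ)) atTop (𝓝 0) :=
    ((Real.tendsto_pow_log_div_mul_add_atTop 1 (-1) 1 one_ne_zero).comp
      (tendsto_atTop_add_const_right _ 1 hl)).congr fun l => by simp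
  have h2 := ((hl.const_div_atTop (Real.log C)).add (h1.const_mul (d : ℝ))).sub_const r
  simp only [mul_zero, add_zero, zero_sub] at h2
  refine h2.congr fun l => ?_
  have : ((l : ℕ) : ℝ) ≠ 0 := by exact_mod_cast l.ne_zero
  rw [Real.log_mul (by positivity) (Real.exp_pos _).ne', Real.log_mul hC.ne' (by positivity),
    Real.log_pow, Real.log_exp]
  field_simp
  ring

variable {Ω S : Type*} [MeasurableSpace Ω] (P : Measure Ω) [IsFiniteMeasure P]
  {Y : ℕ+ → Ω → S} {Γ : Set S} {C : ℝ}

theorem limsup_normLogProb_le (hC : 0 < C) (d : ℕ) (r : ℝ)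
    (h : ∀ᶠ l : ℕ+ in atTop, P.real {ω | Y l ω ∈ Γ} ≤
      C * ((l : ℕ) + 1 : ℝ) ^ d * Real.exp (-((l : ℕ) * r))) :
    limsup (normLogProb P Y Γ) atTop ≤ ((-r : ℝ) : EReal) := by
  rw [← ((continuous_coe_real_ereal.tendsto _).comp
    (tendsto_log_mul_pow_mul_exp_div hC d r)).limsup_eq]
  refine limsup_le_limsup (h.mono fun l hl => ?_)
  simp only [normLogProb, Function.comp_apply, EReal.coe_mul]
  rw [← ENNReal.log_ofReal_of_pos (by positivity), ← ofReal_measureReal]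
  exact mul_le_mul_of_nonneg_left (ENNReal.log_le_log (ENNReal.ofReal_le_ofReal hl))
    (EReal.coe_nonneg.2 (by positivity))

theorem le_liminf_normLogProb (hC : 0 < C) (r : ℝ)
    (h : ∀ᶠ l : ℕ+ in atTop, C * Real.exp (-((l : ℕ) * r)) ≤ P.real {ω | Y l ω ∈ Γ}) :
    ((-r : ℝ) : EReal) ≤ liminf (normLogProb P Y Γ) atTop := by
  rw [← ((continuous_coe_real_ereal.tendsto _).comp
    (tendsto_log_mul_pow_mul_exp_div hC 0 r)).liminf_eq]
  refine liminf_le_liminf (h.mono fun l hl => ?_)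
  simp only [normLogProb, Function.comp_apply, EReal.coe_mul, pow_zero, mul_one]
  rw [← ENNReal.log_ofReal_of_pos (by positivity), ← ofReal_measureReal]
  exact mul_le_mul_of_nonneg_left (ENNReal.log_le_log (ENNReal.ofReal_le_ofReal hl))
    (EReal.coe_nonneg.2 (by positivity))

end Asymptotics

/-! ### Path probabilities of the chain -/

section MarkovChain

variable {Ω A : Type*} [MeasurableSpace Ω] [MeasurableSpace A]
  [MeasurableSingletonClass A] {P : Measure Ω} {X : ℕ → Ω → A} {μ : A × A → ℝ}

theorem measurableSet_eq_state (hX : IsStationaryMarkovChain P X) (t : ℕ) (i : A) :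
    MeasurableSet {ω | X t ω = i} :=
  hX.measurable t (measurableSet_singleton i)

variable [Fintype A] [IsProbabilityMeasure P]

theorem measureReal_state (hX : IsStationaryMarkovChain P X) (hμ : HasDoubletFrequency P X μ)
    (t : ℕ) (i : A) : P.real {ω | X t ω = i} = marginal μ i := by
  have h := sum_measureReal_preimage_singleton (μ := P.restrict {ω | X t ω = i})
    (f := X (t + 1)) Finset.univ fun j _ => measurableSet_eq_state hX (t + 1) j
  rw [Finset.coe_univ, Set.preimage_univ, measureReal_restrict_apply MeasurableSet.univ,
    Set.univ_inter] at h
  rw [← h, marginal]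
  refine Finset.sum_congr rfl fun j _ => ?_
  have hj : MeasurableSet (X (t + 1) ⁻¹' {j}) := measurableSet_eq_state hX (t + 1) j
  rw [← hμ t i j, measureReal_restrict_apply hj, Set.inter_comm]
  rfl

/-- The chain rule; a null past gives no information about the next state, but then both sides
of the induction step vanish. -/
theorem measureReal_path (hX : IsStationaryMarkovChain P X) (hμ : HasDoubletFrequency P X μ)
    (hpos : ∀ p, 0 < μ p) (y : ℕ → A) (n : ℕ) :
    P.real {ω | ∀ s ≤ n, X s ω = y s} =
      marginal μ (y 0) * ∏ t ∈ Finset.range n, transition μ (y t) (y (t + 1)) := by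
  induction n with
  | zero => simpa using measureReal_state hX hμ 0 (y 0)
  | succ n ih =>
    have hB : MeasurableSet {ω | ∀ s ≤ n, X s ω = y s} := by
      simp only [Set.ofPred_forall]
      exact MeasurableSet.iInter fun s => MeasurableSet.iInter fun _ =>
        measurableSet_eq_state hX s _
    have hsplit : {ω | ∀ s ≤ n + 1, X s ω = y s} =
        {ω | ∀ s ≤ n, X s ω = y s} ∩ {ω | X (n + 1) ω = y (n + 1)} := by
      ext ω
      simp only [Set.mem_ofPred_eq, Set.mem_inter_iff, Nat.le_succ_iff_eq_or_le, forall_eq_or_imp]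
      exact and_comm
    have hm : 0 < marginal μ (y n) :=
      (hpos (y n, y n)).trans_le (le_marginal (fun p => (hpos p).le) _ _)
    rw [Finset.prod_range_succ, ← mul_assoc, ← ih, hsplit]
    by_cases h0 : P {ω | ∀ s ≤ n, X s ω = y s} = 0
    · rw [measureReal_def, measureReal_def, measure_mono_null Set.inter_subset_left h0, h0]
      simp
    · have h1 := cond_mul_eq_inter (measurableSet_eq_state hX n (y n))
        {ω | X (n + 1) ω = y (n + 1)} P
      have h2 := congrArg ENNReal.toReal h1
      rw [ENNReal.toReal_mul, ← measureReal_def, ← measureReal_def, ← measureReal_def,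
        measureReal_state hX hμ] at h2
      have h3 : P.real ({ω | X n ω = y n} ∩ {ω | X (n + 1) ω = y (n + 1)}) =
        μ (y n, y (n + 1)) := hμ n _ _
      rw [measureReal_def, ← cond_mul_eq_inter hB, ENNReal.toReal_mul, ← measureReal_def,
        ← measureReal_def, measureReal_def _ {ω | X (n + 1) ω = _}, hX.markov n y _ h0,
        ← measureReal_def, mul_comm, transition, ← h3, ← h2, mul_div_cancel_right₀ _ hm.ne']

theorem measureReal_path_fin (hX : IsStationaryMarkovChain P X) (hμ : HasDoubletFrequency P X μ)
    (hpos : ∀ p, 0 < μ p) {n : ℕ} (x : Fin (n + 1) → A) :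
    P.real ((fun ω (t : Fin (n + 1)) => X t ω) ⁻¹' {x}) =
      marginal μ (x 0) * pathWeight (transition μ) x := by
  set y : ℕ → A := fun t => x (Fin.ofNat (n + 1) t) with hy
  have hyx : ∀ t : Fin (n + 1), y t = x t := fun t => by simp [hy]
  have hset : ((fun ω (t : Fin (n + 1)) => X t ω) ⁻¹' {x}) = {ω | ∀ s ≤ n, X s ω = y s} := by
    ext ω
    simp only [Set.mem_preimage, Set.mem_singleton_iff, funext_iff, Set.mem_ofPred_eq, ← hyx]
    exact ⟨fun h s hs => h ⟨s, Nat.lt_succ_of_le hs⟩, fun h t => h t (Nat.le_of_lt_succ t.2)⟩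
  rw [hset, measureReal_path hX hμ hpos, ← Fin.prod_univ_eq_prod_range
    (fun t => transition μ (y t) (y (t + 1))) n, pathWeight, ← hyx 0]
  congr 1
  refine Finset.prod_congr rfl fun t _ => ?_
  rw [← hyx, ← hyx]
  rfl

/-- Up to constants, the law of the chain is the cyclic weight: the initial probability and the
ghost transition only contribute a bounded factor. -/
theorem exists_measureReal_cycle_bounds [Nonempty A] (hX : IsStationaryMarkovChain P X)
    (hμ : HasDoubletFrequency P X μ) (hpos : ∀ p, 0 < μ p) :
    ∃ k > 0, ∃ K > 0, ∀ (l : ℕ+) (E : Finset (Fin l → A)),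
      k * ∑ x ∈ E, cycleWeight (transition μ) x ≤ P.real {ω | (fun t : Fin l => X t ω) ∈ E} ∧
      P.real {ω | (fun t : Fin l => X t ω) ∈ E} ≤ K * ∑ x ∈ E, cycleWeight (transition μ) x := by
  have hpos' : ∀ p, 0 ≤ μ p := fun p => (hpos p).le
  have ha : ∀ i j, 0 < transition μ i j := fun i j => transition_pos hpos' (hpos _)
  have hm : ∀ i, 0 < marginal μ i := fun i => (hpos (i, i)).trans_le (le_marginal hpos' i i)
  obtain ⟨q, hq⟩ := Finite.exists_min fun p : A × A => marginal μ p.1 / transition μ p.2 p.1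
  obtain ⟨q', hq'⟩ := Finite.exists_max fun p : A × A => marginal μ p.1 / transition μ p.2 p.1
  refine ⟨_, div_pos (hm q.1) (ha q.2 q.1), _, div_pos (hm q'.1) (ha q'.2 q'.1), fun l E => ?_⟩
  obtain ⟨n, hn⟩ := Nat.exists_eq_add_one.2 l.pos
  generalize (l : ℕ) = m at hn E ⊢
  subst hn
  have hmeas : Measurable fun ω (t : Fin (n + 1)) => X t ω :=
    measurable_pi_lambda _ fun t => hX.measurable t
  have hsum : P.real {ω | (fun t : Fin (n + 1) => X t ω) ∈ E} =
      ∑ x ∈ E, marginal μ (x 0) / transition μ (x (Fin.last n)) (x 0) *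
        cycleWeight (transition μ) x := by
    refine (sum_measureReal_preimage_singleton E fun x _ =>
      hmeas (measurableSet_singleton x)).symm.trans (Finset.sum_congr rfl fun x _ => ?_)
    have := (ha (x (Fin.last n)) (x 0)).ne'
    rw [measureReal_path_fin hX hμ hpos, cycleWeight_eq_pathWeight_mul]
    field_simp
  have hW : ∀ x : Fin (n + 1) → A, 0 ≤ cycleWeight (transition μ) x :=
    cycleWeight_nonneg fun i j => (ha i j).le
  rw [hsum, Finset.mul_sum, Finset.mul_sum]
  exact ⟨Finset.sum_le_sum fun x _ => mul_le_mul_of_nonneg_right (hq (_, _)) (hW x),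
    Finset.sum_le_sum fun x _ => mul_le_mul_of_nonneg_right (hq' (_, _)) (hW x)⟩

end MarkovChain

/-! ### The large deviation bounds -/

section LargeDeviations

variable {Ω A : Type*} [MeasurableSpace Ω] [Fintype A] [DecidableEq A] [MeasurableSpace A]
  [MeasurableSingletonClass A] {P : Measure Ω} [IsProbabilityMeasure P] {X : ℕ → Ω → A}
  {μ : A × A → ℝ}

/-- The upper bound needs no closedness, since the bound of the method of types is uniform. -/
theorem limsup_empiricalDoublet_le [Nonempty A] (hX : IsStationaryMarkovChain P X)
    (hμ : HasDoubletFrequency P X μ) (hpos : ∀ p, 0 < μ p) (Γ : Set (stationaryDist A)) {r : ℝ}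
    (hr : ∀ ν ∈ Γ, r ≤ condRelEntropy (ν : A × A → ℝ) μ) :
    limsup (normLogProb P (empiricalDoublet X) Γ) atTop ≤ ((-r : ℝ) : EReal) := by
  classical
  obtain ⟨_, _, K, hK, h⟩ := exists_measureReal_cycle_bounds hX hμ hpos
  have hA : 0 < (Fintype.card A : ℝ) := by exact_mod_cast Fintype.card_pos
  refine limsup_normLogProb_le P (mul_pos hK hA) (Fintype.card (A × A)) r
    (Eventually.of_forall fun l => ?_)
  have h1 := (h l (Finset.univ.filter fun x => ⟨empiricalVec x, empiricalVec_mem l.pos x⟩ ∈ Γ)).2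
  simp only [Finset.mem_filter_univ] at h1
  refine h1.trans ?_
  rw [mul_assoc, mul_assoc, ← mul_assoc (Fintype.card A : ℝ)]
  exact mul_le_mul_of_nonneg_left (sum_cycleWeight_le_exp hpos l.pos _ fun x hx =>
    hr _ (Finset.mem_filter.1 hx).2) hK.le

/-- It suffices to have the lower bound at a positive distribution in `Γ` whose rate is also below
`s`, and one exists by density and continuity. -/
theorem neg_condRelEntropy_le_liminf_empiricalDoublet [Nonempty A]
    (hX : IsStationaryMarkovChain P X) (hμ : HasDoubletFrequency P X μ) (hpos : ∀ p, 0 < μ p)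
    {Γ : Set (stationaryDist A)} (hΓ : IsOpen Γ) {ν : stationaryDist A} (hν : ν ∈ Γ) {s : ℝ}
    (hs : condRelEntropy (ν : A × A → ℝ) μ < s) :
    ((-s : ℝ) : EReal) ≤ liminf (normLogProb P (empiricalDoublet X) Γ) atTop := by
  classical
  obtain ⟨k, hk, _, _, h⟩ := exists_measureReal_cycle_bounds hX hμ hpos
  obtain ⟨U, hU, rfl⟩ := isOpen_induced_iff.1 hΓ
  obtain ⟨κ, hκ, ⟨hκU, hκs⟩, hκ0⟩ := exists_pos_stationaryDist ν.2
    (hU.inter (isOpen_lt (continuous_condRelEntropy_left μ) continuous_const)) ⟨hν, hs⟩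
  obtain ⟨δ, hδ, h1⟩ := exists_exp_le_sum_cycleWeight hpos hκ hκ0 hU hκU hκs
  refine le_liminf_normLogProb P (mul_pos hk hδ) s ?_
  filter_upwards [tendsto_PNat_val_atTop_atTop.eventually h1] with l hl
  have h2 := (h l (Finset.univ.filter fun x => empiricalVec x ∈ U)).1
  simp only [Finset.mem_filter_univ] at h2
  rw [mul_assoc]
  exact (mul_le_mul_of_nonneg_left (hl _ fun x hx => Finset.mem_filter.2
    ⟨Finset.mem_univ x, hx⟩) hk.le).trans h2

end LargeDeviations

theorem mainTheorem1 {Ω A : Type*} [MeasurableSpace Ω] [Fintype A] [DecidableEq A]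
    [MeasurableSpace A] [MeasurableSingletonClass A]
    (P : Measure Ω) [IsProbabilityMeasure P] (X : ℕ → Ω → A)
    (hX : IsStationaryMarkovChain P X)
    (μ : A × A → ℝ) (hμ : HasDoubletFrequency P X μ) (hpos : ∀ i j, 0 < μ (i, j)) :
    SatisfiesLDP P (empiricalDoublet X)
      (fun ν : stationaryDist A => ((condRelEntropy (ν : A × A → ℝ) μ : ℝ) : EReal)) ∧
    LowerSemicontinuous
      (fun ν : stationaryDist A => ((condRelEntropy (ν : A × A → ℝ) μ : ℝ) : EReal)) ∧
    ∀ ν ∈ stationaryDist A, condRelEntropy ν μ =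
      ∑ i, marginal ν i * ∑ j, transition ν i j *
        Real.log (transition ν i j / transition μ i j) := by
  have hpos' : ∀ p, 0 < μ p := fun p => hpos p.1 p.2
  have : Nonempty A := by
    obtain ⟨ω⟩ := nonempty_of_isProbabilityMeasure P
    exact ⟨X 0 ω⟩
  -- Both infima are approached through real numbers, which also covers the empty set.
  refine ⟨⟨fun Γ hΓ => ?_, fun Γ _ => ?_⟩, ?_, fun ν hν =>
    condRelEntropy_eq_sum_marginal hν.1.1 hpos'⟩
  · refine EReal.neg_le_of_neg_le (le_iInf₂ fun ν hν => ?_)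
    refine EReal.le_of_forall_lt_iff_le.1 fun s hs => EReal.neg_le_of_neg_le ?_
    rw [← EReal.coe_neg]
    exact neg_condRelEntropy_le_liminf_empiricalDoublet hX hμ hpos' hΓ hν
      (EReal.coe_lt_coe_iff.1 hs)
  · refine EReal.le_neg_of_le_neg (EReal.ge_of_forall_gt_iff_ge.1 fun r hr => ?_)
    refine EReal.le_neg_of_le_neg ?_
    rw [← EReal.coe_neg]
    exact limsup_empiricalDoublet_le hX hμ hpos' Γ fun ν hν =>
      EReal.coe_le_coe_iff.1 (hr.le.trans (iInf₂_le ν hν))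
  · exact (continuous_coe_real_ereal.comp
      ((continuous_condRelEntropy_left μ).comp continuous_subtype_val)).lowerSemicontinuous
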